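/- Let $p\ge 9$ be real. For $f\in H^1(\mathbb R)$ (complex valued) let $e^{ir\partial_x^2}f$ be the free Schrödinger evolution, i.e. the Fourier multiplier with symbol $e^{-ir(2\pi\xi)^2}$ in the normalization $\hat f(\xi)=\int_{\mathbb R} e^{-2\pi i x\xi}f(x)\,dx$, and put $$\mathcal C_p=\sup_{0\ne f\in H^1(\mathbb R)}\frac{\int_{\mathbb R}\int_{\mathbb R}|(e^{ir\partial_x^2}f)(x)|^{p+1}\,dx\,dr}{\|f\|_{L^2}^{\frac{p+7}{2}}\,\|\partial_xf\|_{L^2}^{\frac{p-5}{2}}}.$$ Then $$\frac{2^{\frac{p-7}{4}}}{\pi^{\frac{p-1}{4}}(p+1)^{\frac12}}\,B\Big(\frac12,\frac{p-3}{4}\Big)=\frac{2^{\frac{p-7}{4}}}{\pi^{\frac{p-3}{4}}(p+1)^{\frac12}}\,\frac{\Gamma(\frac{p-3}{4})}{\Gamma(\frac{p-1}{4})}\le\mathcal C_p\le\frac1{2\sqrt3},$$ where $B$ is the beta function and $\Gamma$ is the gamma function. In particular $$\frac{1}{2\sqrt5\,\pi}\le\mathcal C_9\le\frac1{2\sqrt3}.$$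 -/

import Mathlib

open MeasureTheory
open scoped ENNReal FourierTransform SchwartzMap

namespace GabitovTuritsyn

noncomputable section

/-- The Lebesgue space `L²(ℝ)` of complex valued functions. -/
abbrev L2 : Type := Lp ℂ 2 (volume : Measure ℝ)

/-- `g` is the weak (distributional) derivative of `f`, i.e.
`∫ g φ = - ∫ f φ'` for every Schwartz function `φ`. -/
def HasWeakDeriv (f g : L2) : Prop :=
  TemperedDistribution.derivCLM ℂ (f : 𝓢'(ℝ, ℂ)) = (g : 𝓢'(ℝ, ℂ))

/-- The Sobolev space `H¹(ℝ)`, as a set of functions in `L²(ℝ)`. -/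
def H1 : Set L2 := {f | TemperedDistribution.MemSobolev 1 2 (f : 𝓢'(ℝ, ℂ))}

theorem exists_hasWeakDeriv {f : L2} (hf : f ∈ H1) : ∃ g : L2, HasWeakDeriv f g := by
  have h : TemperedDistribution.MemSobolev 1 2 (f : 𝓢'(ℝ, ℂ)) := hf
  have h' := h.lineDerivOp (m := (1 : ℝ))
  rw [sub_self, TemperedDistribution.memSobolev_zero_iff] at h'
  obtain ⟨g, hg⟩ := h'
  exact ⟨g, hg⟩

theorem HasWeakDeriv.unique {f g₁ g₂ : L2} (h₁ : HasWeakDeriv f g₁) (h₂ : HasWeakDeriv f g₂) :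
    g₁ = g₂ := by
  have h : Lp.toTemperedDistributionCLM ℂ (volume : Measure ℝ) 2 g₁ =
      Lp.toTemperedDistributionCLM ℂ (volume : Measure ℝ) 2 g₂ := h₁.symm.trans h₂
  exact LinearMap.ker_eq_bot.1 Lp.ker_toTemperedDistributionCLM_eq_bot h

/-- The weak derivative `∂ₓ f ∈ L²(ℝ)` of `f ∈ H¹(ℝ)`. -/
def weakDeriv (f : H1) : L2 := (exists_hasWeakDeriv f.2).choose

theorem hasWeakDeriv_weakDeriv (f : H1) : HasWeakDeriv f (weakDeriv f) :=
  (exists_hasWeakDeriv f.2).choose_spec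

/-- The symbol of `e^{ir∂ₓ²}`: in the normalization `𝓕 f (ξ) = ∫ e^{-2πixξ} f(x) dx` the operator
`∂ₓ²` is multiplication by `-(2πξ)²`. -/
def schrodingerSymbol (r ξ : ℝ) : ℂ :=
  Complex.exp (-(Complex.I * (r : ℂ) * ((2 * Real.pi * ξ) ^ 2 : ℝ)))

theorem memLp_schrodingerSymbol (r : ℝ) :
    MemLp (schrodingerSymbol r) ∞ (volume : Measure ℝ) := by
  refine memLp_top_of_bound (C := 1) ?_ (Filter.Eventually.of_forall fun ξ => ?_)
  · apply Continuous.aestronglyMeasurable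
    unfold schrodingerSymbol
    fun_prop
  · have h : -(Complex.I * (r : ℂ) * ((2 * Real.pi * ξ) ^ 2 : ℝ)) =
        ((-(r * (2 * Real.pi * ξ) ^ 2) : ℝ) : ℂ) * Complex.I := by
      push_cast
      ring
    rw [schrodingerSymbol, h, Complex.norm_exp_ofReal_mul_I]

/-- The free Schrödinger propagator `e^{ir∂ₓ²}` on `L²(ℝ)`, the Fourier multiplier operator
`f ↦ 𝓕⁻¹ (e^{-ir(2πξ)²} 𝓕 f)`. -/
def propagator (r : ℝ) (f : L2) : L2 :=
  𝓕⁻ ((((memLp_schrodingerSymbol r).toLp _ : Lp ℂ ∞ (volume : Measure ℝ)) • 𝓕 f : L2))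

/-- The space-time quantity
`‖e^{ir∂ₓ²} f‖_{L^q_{r,x}}^q = ∫_ℝ ∫_ℝ |(e^{ir∂ₓ²} f)(x)|^q dx dr`, in `[0, ∞]`. -/
def spaceTimeNormPow (q : ℝ) (f : L2) : ℝ≥0∞ :=
  ∫⁻ r : ℝ, ∫⁻ x : ℝ, ‖(propagator r f : ℝ → ℂ) x‖ₑ ^ q

/-- The Weinstein functional
`W_p(f) = ‖e^{ir∂ₓ²} f‖_{L^{p+1}_{r,x}}^{p+1} / (‖f‖^{(p+7)/2} ‖∂ₓ f‖^{(p-5)/2})`,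
with `L²` norms in the denominator. -/
def weinstein (p : ℝ) (f : H1) : ℝ≥0∞ :=
  spaceTimeNormPow (p + 1) (f : L2) /
    ENNReal.ofReal (‖(f : L2)‖ ^ ((p + 7) / 2) * ‖weakDeriv f‖ ^ ((p - 5) / 2))

/-- The sharp constant `C_p = sup W_p(f)` over all nonzero `f ∈ H¹(ℝ)`, in `[0, ∞]`. -/
def sharpConst (p : ℝ) : ℝ≥0∞ :=
  ⨆ (f : H1) (_ : (f : L2) ≠ 0), weinstein p f

end

end GabitovTuritsyn

namespace GabitovTuritsyn

/-! Write u for the free evolution of f.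

Upper bound: the L¹ norm of the Fourier transform of f bounds |u| at all times, so |u|^(p+1) is at
most that norm to the power p - 5 times |u|^6. Two sharp inequalities finish:
`HasWeakDeriv.sq_lintegral_fourier_le` bounds the square of the L¹ norm by ‖f‖‖∂ₓf‖, and
`lintegral_freeEvolution_pow_six_le` bounds the L⁶ space-time integral by ‖f‖⁶/(2√3). The powers add
up because (p - 5)/2 + 6 = (p + 7)/2; only p ≥ 5 is needed.

The L⁶ bound comes from writing |u|^6 as |u³|². The Fourier transform of u³ at σ is an integral over
the plane ξ₁ + ξ₂ + ξ₃ = σ, on which |ξ|² = σ²/3 + |z|² with z in an orthonormal planar frame. After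
Plancherel in x, the phase in σ has modulus one, and for fixed σ the integral in r is controlled by
`lintegral_planar_sq_le`: in polar coordinates the phase depends on ρ² alone, so Plancherel in ρ²
and Cauchy-Schwarz over the circle give the factor 1/2.

Lower bound: the quotient is evaluated at a Gaussian. Its evolution has explicit modulus, the
x-integral is Gaussian and the r-integral is a beta integral. -/

/-! ### Fourier integrals and Plancherel on L¹ ∩ L². -/

theorem integral_fourierInv_mul_eq_of_integrable {φ g : ℝ → ℂ} (hφ : Integrable φ)
    (hg : Integrable g) : ∫ x, 𝓕⁻ φ x * g x = ∫ x, φ x * 𝓕⁻ g x := by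
  have h := VectorFourier.integral_fourierIntegral_smul_eq_flip (μ := volume) (ν := volume)
    (L := -(innerₗ ℝ : ℝ →ₗ[ℝ] ℝ →ₗ[ℝ] ℝ)) (e := Real.fourierChar) (f := φ) (g := g)
    Real.continuous_fourierChar (by
      simp only [LinearMap.neg_apply, innerₗ_apply_apply]; fun_prop) hφ hg
  have hflip : (-(innerₗ ℝ : ℝ →ₗ[ℝ] ℝ →ₗ[ℝ] ℝ)).flip = -(innerₗ ℝ) := by
    ext
    simp
  rw [hflip] at h
  exact h

/-- On `L¹ ∩ L²` the inverse Fourier transform of `L²` is given by the Fourier integral. -/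
theorem coeFn_fourierInv_ae_eq (g : L2) (hg : Integrable (g : ℝ → ℂ)) :
    ((𝓕⁻ g : L2) : ℝ → ℂ) =ᵐ[volume] 𝓕⁻ (g : ℝ → ℂ) := by
  have hcont : Continuous (𝓕⁻ (g : ℝ → ℂ)) := by
    rw [Real.fourierInv_eq_fourier_comp_neg]
    exact VectorFourier.fourierIntegral_continuous Real.continuous_fourierChar
      (by exact continuous_inner) hg.comp_neg
  -- Both sides are locally integrable, so it suffices to test against smooth compactly supported φ.
  -- The distributional Fourier transform handles the left side and the multiplication formula above
  -- the right.
  refine ae_eq_of_integral_contDiff_smul_eq ((Lp.memLp _).locallyIntegrable (by norm_num))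
    hcont.locallyIntegrable ?_
  intro φ hφ hφc
  have h1 : HasCompactSupport (Complex.ofRealCLM ∘ φ) := hφc.comp_left rfl
  have h2 := Complex.ofRealCLM.contDiff.comp hφ
  set ψ : 𝓢(ℝ, ℂ) := h1.toSchwartzMap h2 with hψ
  have hψe : ∀ x, ψ x = (φ x : ℂ) := fun x => rfl
  have key : ((𝓕⁻ g : L2) : 𝓢'(ℝ, ℂ)) ψ = (g : 𝓢'(ℝ, ℂ)) (𝓕⁻ ψ) := by
    rw [← Lp.fourierInv_toTemperedDistribution_eq]
    rfl
  rw [Lp.toTemperedDistribution_apply, Lp.toTemperedDistribution_apply] at key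
  calc ∫ x, φ x • ((𝓕⁻ g : L2) : ℝ → ℂ) x = ∫ x, ψ x • ((𝓕⁻ g : L2) : ℝ → ℂ) x := by
        simp only [hψe]; rfl
    _ = ∫ x, (𝓕⁻ ψ) x • (g : ℝ → ℂ) x := key
    _ = ∫ x, ψ x * 𝓕⁻ (g : ℝ → ℂ) x := by
        rw [SchwartzMap.fourierInv_coe]
        exact integral_fourierInv_mul_eq_of_integrable ψ.integrable hg
    _ = _ := by simp only [hψe]; rfl

theorem lintegral_enorm_sq_eq (g : L2) : ∫⁻ x, ‖(g : ℝ → ℂ) x‖ₑ ^ 2 = ‖g‖ₑ ^ 2 := by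
  rw [Lp.enorm_def, eLpNorm_eq_lintegral_rpow_enorm_toReal (by norm_num) (by norm_num)]
  rw [← ENNReal.rpow_natCast, ← ENNReal.rpow_mul]
  simp

/-- One half of Plancherel's theorem, for the Fourier integral of an integrable function. -/
theorem lintegral_fourierInv_sq_le {h : ℝ → ℂ} (hh : Integrable h) :
    ∫⁻ x, ‖𝓕⁻ h x‖ₑ ^ 2 ≤ ∫⁻ x, ‖h x‖ₑ ^ 2 := by
  by_cases hfin : ∫⁻ x, ‖h x‖ₑ ^ 2 = ∞
  · simp [hfin]
  have hmem : MemLp h 2 := by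
    refine ⟨hh.aestronglyMeasurable, ?_⟩
    rw [eLpNorm_lt_top_iff_lintegral_rpow_enorm_lt_top (by norm_num) (by norm_num)]
    simpa using lt_top_iff_ne_top.2 hfin
  set g : L2 := hmem.toLp h
  have hg : (g : ℝ → ℂ) =ᵐ[volume] h := hmem.coeFn_toLp
  have h1 := coeFn_fourierInv_ae_eq g (hh.congr hg.symm)
  have e1 : 𝓕⁻ (g : ℝ → ℂ) = 𝓕⁻ h := funext fun x => Real.fourierInv_congr_ae hg x
  rw [e1] at h1
  calc ∫⁻ x, ‖𝓕⁻ h x‖ₑ ^ 2 = ∫⁻ x, ‖((𝓕⁻ g : L2) : ℝ → ℂ) x‖ₑ ^ 2 :=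
        lintegral_congr_ae (by filter_upwards [h1] with x hx; rw [hx])
    _ = ‖(𝓕⁻ g : L2)‖ₑ ^ 2 := lintegral_enorm_sq_eq _
    _ = ‖g‖ₑ ^ 2 := by
        have : ‖(𝓕⁻ g : L2)‖ = ‖g‖ := (Lp.fourierTransformₗᵢ ℝ ℂ).symm.norm_map g
        rw [enorm_eq_iff_norm_eq.2 this]
    _ = ∫⁻ x, ‖(g : ℝ → ℂ) x‖ₑ ^ 2 := (lintegral_enorm_sq_eq _).symm
    _ = ∫⁻ x, ‖h x‖ₑ ^ 2 :=
        lintegral_congr_ae (by filter_upwards [hg] with x hx; rw [hx])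
    _ ≤ _ := le_rfl


/-! ### Oscillatory integrals with radial phase in the plane. -/

theorem lintegral_mul_sq_le {α : Type*} [MeasurableSpace α] (μ : Measure α) {f g : α → ℝ≥0∞}
    (hf : AEMeasurable f μ) (hg : AEMeasurable g μ) :
    (∫⁻ a, f a * g a ∂μ) ^ 2 ≤ (∫⁻ a, f a ^ 2 ∂μ) * ∫⁻ a, g a ^ 2 ∂μ := by
  have h := ENNReal.lintegral_mul_le_Lp_mul_Lq μ Real.HolderConjugate.two_two hf hg
  calc (∫⁻ a, f a * g a ∂μ) ^ 2
      ≤ ((∫⁻ a, f a ^ (2 : ℝ) ∂μ) ^ (1 / 2 : ℝ) * (∫⁻ a, g a ^ (2 : ℝ) ∂μ) ^ (1 / 2 : ℝ)) ^ 2 := by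
        gcongr
        exact h
    _ = _ := by
        rw [mul_pow, ← ENNReal.rpow_natCast, ← ENNReal.rpow_natCast, ← ENNReal.rpow_mul,
          ← ENNReal.rpow_mul]
        simp

theorem enorm_setIntegral_sq_le (f : ℝ → ℂ) (hf : Measurable f) (s : Set ℝ) :
    ‖∫ x in s, f x‖ₑ ^ 2 ≤ volume s * ∫⁻ x in s, ‖f x‖ₑ ^ 2 := by
  calc ‖∫ x in s, f x‖ₑ ^ 2 ≤ (∫⁻ x in s, 1 * ‖f x‖ₑ) ^ 2 := by
        gcongr
        simpa using enorm_integral_le_lintegral_enorm f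
    _ ≤ _ := by
        refine (lintegral_mul_sq_le _ (by fun_prop) (by fun_prop)).trans (le_of_eq ?_)
        simp

theorem image_two_pi_mul_sq : (fun ρ : ℝ => 2 * Real.pi * ρ ^ 2) '' Set.Ioi 0 = Set.Ioi 0 := by
  have hpi := Real.pi_pos
  ext w
  simp only [Set.mem_image, Set.mem_Ioi]
  constructor
  · rintro ⟨ρ, hρ, rfl⟩
    positivity
  · intro hw
    refine ⟨√(w / (2 * Real.pi)), by positivity, ?_⟩
    rw [Real.sq_sqrt (by positivity)]
    field_simp

theorem injOn_two_pi_mul_sq : Set.InjOn (fun ρ : ℝ => 2 * Real.pi * ρ ^ 2) (Set.Ioi 0) := by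
  intro a ha b hb h
  simp only [mul_eq_mul_left_iff, mul_eq_zero, OfNat.ofNat_ne_zero, Real.pi_ne_zero,
    or_self, or_false] at h
  exact (pow_left_inj₀ (le_of_lt ha) (le_of_lt hb) two_ne_zero).1 h

theorem hasDerivAt_two_pi_mul_sq (ρ : ℝ) :
    HasDerivAt (fun ρ : ℝ => 2 * Real.pi * ρ ^ 2) (4 * Real.pi * ρ) ρ := by
  convert! (hasDerivAt_pow 2 ρ).const_mul (2 * Real.pi) using 1
  push_cast
  ring

/-- Plancherel's theorem on the half line in the variable `2πρ²`. -/
theorem lintegral_radial_sq_le (Q : ℝ → ℂ) (hQ : IntegrableOn Q (Set.Ioi 0)) :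
    ∫⁻ r : ℝ, ‖∫ ρ in Set.Ioi (0 : ℝ),
        Complex.exp (-(Complex.I * (r : ℂ) * ((2 * Real.pi * ρ) ^ 2 : ℝ))) * Q ρ‖ₑ ^ 2 ≤
      ∫⁻ ρ in Set.Ioi (0 : ℝ), ENNReal.ofReal (1 / (4 * Real.pi * ρ)) * ‖Q ρ‖ₑ ^ 2 := by
  have hpi := Real.pi_pos
  set φ : ℝ → ℝ := fun ρ => 2 * Real.pi * ρ ^ 2 with hφ
  have hder : ∀ x ∈ Set.Ioi (0 : ℝ), HasDerivWithinAt φ (4 * Real.pi * x) (Set.Ioi 0) x :=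
    fun x _ => (hasDerivAt_two_pi_mul_sq x).hasDerivWithinAt
  -- The density of `Q` in the variable w = 2πρ², that is, Q(ρ) divided by dw/dρ = 4πρ.
  set h : ℝ → ℂ := fun w =>
    (1 / (4 * Real.pi * √(w / (2 * Real.pi))) : ℝ) * Q (√(w / (2 * Real.pi))) with hh
  have hhφ : ∀ ρ ∈ Set.Ioi (0 : ℝ), h (φ ρ) = (1 / (4 * Real.pi * ρ) : ℝ) * Q ρ := by
    intro ρ hρ
    have : √(φ ρ / (2 * Real.pi)) = ρ := by
      rw [hφ]
      simp only
      rw [mul_div_cancel_left₀ _ (by positivity), Real.sqrt_sq (le_of_lt hρ)]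
    simp only [hh, this]
  have hsmul : ∀ ρ ∈ Set.Ioi (0 : ℝ), |4 * Real.pi * ρ| • h (φ ρ) = Q ρ := by
    intro ρ hρ
    have hρ' : (0 : ℝ) < ρ := hρ
    rw [hhφ ρ hρ, abs_of_pos (by positivity), Complex.real_smul, ← mul_assoc, ← Complex.ofReal_mul,
      mul_one_div_cancel (by positivity)]
    simp
  have hint : IntegrableOn h (Set.Ioi 0) := by
    rw [← image_two_pi_mul_sq, integrableOn_image_iff_integrableOn_abs_deriv_smul measurableSet_Ioi
      hder injOn_two_pi_mul_sq]
    exact hQ.congr_fun (fun ρ hρ => (hsmul ρ hρ).symm) measurableSet_Ioi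
  set H : ℝ → ℂ := (Set.Ioi 0).indicator h with hH
  have hHint : Integrable H := hint.integrable_indicator measurableSet_Ioi
  -- Since r(2πρ)² = 2πrw, the oscillatory integral is an inverse Fourier integral at frequency -r.
  have hF : ∀ r : ℝ, ∫ ρ in Set.Ioi (0 : ℝ),
        Complex.exp (-(Complex.I * (r : ℂ) * ((2 * Real.pi * ρ) ^ 2 : ℝ))) * Q ρ = 𝓕⁻ H (-r) := by
    intro r
    rw [Real.fourierInv_eq']
    have e : (fun v : ℝ => Complex.exp (↑(2 * Real.pi * inner ℝ v (-r)) * Complex.I) • H v) =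
        (Set.Ioi 0).indicator
          (fun v : ℝ => Complex.exp (↑(2 * Real.pi * inner ℝ v (-r)) * Complex.I) • h v) := by
      funext v
      by_cases hv : v ∈ Set.Ioi (0 : ℝ) <;> simp [hH, hv]
    rw [e, integral_indicator measurableSet_Ioi]
    conv_rhs => rw [← image_two_pi_mul_sq]
    rw [integral_image_eq_integral_abs_deriv_smul measurableSet_Ioi hder injOn_two_pi_mul_sq]
    refine setIntegral_congr_fun measurableSet_Ioi fun ρ hρ => ?_
    rw [smul_comm, hsmul ρ hρ, smul_eq_mul]
    congr 2
    simp only [hφ, RCLike.inner_apply, conj_trivial]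
    push_cast
    ring
  calc ∫⁻ r : ℝ, ‖∫ ρ in Set.Ioi (0 : ℝ),
        Complex.exp (-(Complex.I * (r : ℂ) * ((2 * Real.pi * ρ) ^ 2 : ℝ))) * Q ρ‖ₑ ^ 2
      = ∫⁻ r : ℝ, ‖𝓕⁻ H (-r)‖ₑ ^ 2 := by simp_rw [hF]
    _ = ∫⁻ r : ℝ, ‖𝓕⁻ H r‖ₑ ^ 2 := lintegral_neg_eq_self (fun r => ‖𝓕⁻ H r‖ₑ ^ 2)
    _ ≤ ∫⁻ w, ‖H w‖ₑ ^ 2 := lintegral_fourierInv_sq_le hHint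
    _ = ∫⁻ w, (Set.Ioi 0).indicator (fun w => ‖h w‖ₑ ^ 2) w := by
        refine lintegral_congr fun w => ?_
        by_cases hv : w ∈ Set.Ioi (0 : ℝ) <;> simp [hH, hv]
    _ = ∫⁻ w in Set.Ioi 0, ‖h w‖ₑ ^ 2 := lintegral_indicator measurableSet_Ioi _
    _ = ∫⁻ w in φ '' Set.Ioi 0, ‖h w‖ₑ ^ 2 := by rw [image_two_pi_mul_sq]
    _ = ∫⁻ ρ in Set.Ioi (0 : ℝ), ENNReal.ofReal |4 * Real.pi * ρ| * ‖h (φ ρ)‖ₑ ^ 2 := by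
        rw [lintegral_image_eq_lintegral_abs_deriv_mul measurableSet_Ioi hder injOn_two_pi_mul_sq]
    _ = _ := by
        refine setLIntegral_congr_fun measurableSet_Ioi fun ρ hρ => ?_
        have hρ' : (0 : ℝ) < ρ := hρ
        rw [hhφ ρ hρ, abs_of_pos (by positivity), enorm_mul, mul_pow, ← mul_assoc]
        congr 1
        rw [← ofReal_norm, Complex.norm_real, Real.norm_of_nonneg (by positivity),
          ← ENNReal.ofReal_pow (by positivity), ← ENNReal.ofReal_mul (by positivity)]
        congr 1
        field_simp

/-- The planar estimate behind the sharp Strichartz inequality: Plancherel in the radial variable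
and the Cauchy-Schwarz inequality in the angular variable. -/
theorem lintegral_planar_sq_le (Φ : ℝ × ℝ → ℂ) (hm : Measurable Φ) (hΦ : Integrable Φ) :
    ∫⁻ r : ℝ, ‖∫ z, Complex.exp (-(Complex.I * (r : ℂ) *
        ((2 * Real.pi) ^ 2 * (z.1 ^ 2 + z.2 ^ 2) : ℝ))) * Φ z‖ₑ ^ 2 ≤
      ENNReal.ofReal (1 / 2) * ∫⁻ z, ‖Φ z‖ₑ ^ 2 := by
  have hpi := Real.pi_pos
  have hmp : Measurable (polarCoord.symm : ℝ × ℝ → ℝ × ℝ) := by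
    have : Continuous (polarCoord.symm : ℝ × ℝ → ℝ × ℝ) := continuous_polarCoord_symm
    exact this.measurable
  set P : ℝ × ℝ → ℂ := fun p => p.1 • Φ (polarCoord.symm p) with hP
  have hPm : Measurable P := by
    simp only [hP]
    exact measurable_fst.smul (hm.comp hmp)
  have hPint : IntegrableOn P (Set.Ioi 0 ×ˢ Set.Ioo (-Real.pi) Real.pi)
      ((volume : Measure ℝ).prod volume) := by
    rw [← polarCoord_target]
    have h1 : IntegrableOn Φ (polarCoord.symm '' polarCoord.target) := hΦ.integrableOn
    rw [integrableOn_image_iff_integrableOn_abs_det_fderiv_smul volume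
      polarCoord.open_target.measurableSet
      (fun p _ ↦ (hasFDerivAt_polarCoord_symm p).hasFDerivWithinAt) polarCoord.symm.injOn] at h1
    refine h1.congr_fun (fun p hp => ?_) polarCoord.open_target.measurableSet
    simp only [det_fderivPolarCoordSymm, hP]
    rw [abs_of_pos hp.1]
  set Q : ℝ → ℂ := fun ρ => ∫ θ in Set.Ioo (-Real.pi) Real.pi, P (ρ, θ) with hQ
  have hQint : IntegrableOn Q (Set.Ioi 0) := by
    have h1 := hPint
    rw [IntegrableOn, ← Measure.prod_restrict] at h1
    exact h1.integral_prod_left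
  have hpol : ∀ r : ℝ, ∫ z, Complex.exp (-(Complex.I * (r : ℂ) *
        ((2 * Real.pi) ^ 2 * (z.1 ^ 2 + z.2 ^ 2) : ℝ))) * Φ z = ∫ ρ in Set.Ioi (0 : ℝ),
        Complex.exp (-(Complex.I * (r : ℂ) * ((2 * Real.pi * ρ) ^ 2 : ℝ))) * Q ρ := by
    intro r
    rw [← integral_comp_polarCoord_symm, polarCoord_target]
    have e : ∀ p : ℝ × ℝ, p.1 • (Complex.exp (-(Complex.I * (r : ℂ) *
        ((2 * Real.pi) ^ 2 * ((polarCoord.symm p).1 ^ 2 + (polarCoord.symm p).2 ^ 2) : ℝ))) *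
          Φ (polarCoord.symm p)) =
        Complex.exp (-(Complex.I * (r : ℂ) * ((2 * Real.pi * p.1) ^ 2 : ℝ))) * P p := by
      intro p
      simp only [hP]
      rw [mul_smul_comm]
      have : (2 * Real.pi) ^ 2 * ((polarCoord.symm p).1 ^ 2 + (polarCoord.symm p).2 ^ 2) =
          (2 * Real.pi * p.1) ^ 2 := by
        rw [polarCoord_symm_apply]
        simp only
        linear_combination (2 * Real.pi) ^ 2 * p.1 ^ 2 * Real.cos_sq_add_sin_sq p.2
      rw [this]
    simp_rw [e]
    rw [Measure.volume_eq_prod, setIntegral_prod]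
    · refine setIntegral_congr_fun measurableSet_Ioi fun ρ _ => ?_
      simp only [hQ]
      rw [integral_const_mul]
    · refine hPint.bdd_mul (c := 1) ?_ ?_
      · apply Continuous.aestronglyMeasurable
        fun_prop
      · refine Filter.Eventually.of_forall fun p => ?_
        have h : -(Complex.I * (r : ℂ) * ((2 * Real.pi * p.1) ^ 2 : ℝ)) =
            ((-(r * (2 * Real.pi * p.1) ^ 2) : ℝ) : ℂ) * Complex.I := by
          push_cast
          ring
        rw [h, Complex.norm_exp_ofReal_mul_I]
  simp_rw [hpol]
  refine (lintegral_radial_sq_le Q hQint).trans ?_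
  rw [← lintegral_comp_polarCoord_symm, polarCoord_target, Measure.volume_eq_prod,
    setLIntegral_prod, ← lintegral_const_mul']
  · refine setLIntegral_mono' measurableSet_Ioi fun ρ hρ => ?_
    have hρ' : (0 : ℝ) < ρ := hρ
    -- Cauchy-Schwarz on a circle of angular length 2π turns 1/(4πρ) into 1/(2ρ). As `P` carries a
    -- factor ρ, its square leaves ρ/2: half the polar Jacobian.
    calc ENNReal.ofReal (1 / (4 * Real.pi * ρ)) * ‖Q ρ‖ₑ ^ 2
        ≤ ENNReal.ofReal (1 / (4 * Real.pi * ρ)) * (ENNReal.ofReal (2 * Real.pi) *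
          ∫⁻ θ in Set.Ioo (-Real.pi) Real.pi, ‖P (ρ, θ)‖ₑ ^ 2) := by
          gcongr
          refine (enorm_setIntegral_sq_le _ (hPm.comp measurable_prodMk_left) _).trans
            (le_of_eq ?_)
          rw [Real.volume_Ioo]
          congr 2
          ring
      _ = ENNReal.ofReal (1 / (2 * ρ)) * ∫⁻ θ in Set.Ioo (-Real.pi) Real.pi, ‖P (ρ, θ)‖ₑ ^ 2 := by
          rw [← mul_assoc, ← ENNReal.ofReal_mul (by positivity)]
          congr 2
          field_simp
          norm_num
      _ = ENNReal.ofReal (1 / 2) * ∫⁻ θ in Set.Ioo (-Real.pi) Real.pi,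
          ENNReal.ofReal ρ • ‖Φ (polarCoord.symm (ρ, θ))‖ₑ ^ 2 := by
          rw [← lintegral_const_mul' _ _ (by simp), ← lintegral_const_mul' _ _ (by simp)]
          refine lintegral_congr fun θ => ?_
          simp only [hP, enorm_smul, smul_eq_mul]
          rw [Real.enorm_eq_ofReal hρ'.le, mul_pow, ← mul_assoc, ← mul_assoc,
            ← ENNReal.ofReal_pow hρ'.le, ← ENNReal.ofReal_mul (by positivity),
            ← ENNReal.ofReal_mul (by positivity)]
          congr 2
          field_simp
  · simp
  · apply Measurable.aemeasurable
    simp only [smul_eq_mul]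
    have := (hm.comp hmp).enorm
    exact (measurable_fst.ennreal_ofReal).mul (this.pow_const 2)


/-! ### Coordinates on ℝ³ adapted to the diagonal. -/

/-- The columns are `(1, 1, 1) / 3` and an orthonormal basis of the plane orthogonal to it. -/
noncomputable def diagonalFrame : Matrix (Fin 3) (Fin 3) ℝ :=
  !![1 / 3, 1 / √2, 1 / √6; 1 / 3, -(1 / √2), 1 / √6; 1 / 3, 0, -(2 / √6)]

theorem det_diagonalFrame : diagonalFrame.det = 1 / √3 := by
  have h2 : √2 * √2 = 2 := Real.mul_self_sqrt (by norm_num)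
  have h3 : √3 * √3 = 3 := Real.mul_self_sqrt (by norm_num)
  have h6 : √6 = √2 * √3 := by
    rw [← Real.sqrt_mul (by norm_num)]
    norm_num
  have p2 : √2 ≠ 0 := by positivity
  have p3 : √3 ≠ 0 := by positivity
  rw [diagonalFrame, Matrix.det_fin_three]
  simp
  rw [h6]
  field_simp
  linear_combination (-3) * h2

/-- Coordinates on `ℝ³` adapted to the diagonal. -/
noncomputable def diagonalCoord (y : ℝ × ℝ × ℝ) : Fin 3 → ℝ :=
  ![y.1 / 3 + y.2.1 / √2 + y.2.2 / √6, y.1 / 3 - y.2.1 / √2 + y.2.2 / √6,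
    y.1 / 3 - 2 * y.2.2 / √6]

theorem sum_diagonalCoord (y : ℝ × ℝ × ℝ) :
    diagonalCoord y 0 + diagonalCoord y 1 + diagonalCoord y 2 = y.1 := by
  simp [diagonalCoord]
  ring

/-- The frame columns are orthogonal with squared lengths 1/3, 1, 1. Hence the Schrödinger phase
splits into a function of the total frequency and a radial function on the plane. -/
theorem sum_sq_diagonalCoord (y : ℝ × ℝ × ℝ) :
    diagonalCoord y 0 ^ 2 + diagonalCoord y 1 ^ 2 + diagonalCoord y 2 ^ 2 =
      y.1 ^ 2 / 3 + (y.2.1 ^ 2 + y.2.2 ^ 2) := by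
  have h2 : √2 ^ 2 = 2 := Real.sq_sqrt (by norm_num)
  have h6 : √6 ^ 2 = 6 := Real.sq_sqrt (by norm_num)
  simp only [diagonalCoord, Matrix.cons_val]
  have e2 : (y.2.1 / √2) ^ 2 = y.2.1 ^ 2 / 2 := by rw [div_pow, h2]
  have e6 : (y.2.2 / √6) ^ 2 = y.2.2 ^ 2 / 6 := by rw [div_pow, h6]
  rw [mul_div_assoc]
  linear_combination 2 * e2 + 6 * e6

/-- The volume preserving identification of `ℝ × ℝ × ℝ` with `ℝ³`. -/
def tripleEquiv : (ℝ × ℝ × ℝ) ≃ᵐ (Fin 3 → ℝ) :=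
  ((MeasurableEquiv.refl ℝ).prodCongr (MeasurableEquiv.finTwoArrow (α := ℝ)).symm).trans
    (MeasurableEquiv.piFinSuccAbove (fun _ : Fin 3 => ℝ) 0).symm

theorem tripleEquiv_apply (y : ℝ × ℝ × ℝ) : tripleEquiv y = ![y.1, y.2.1, y.2.2] := by
  funext i
  fin_cases i <;> rfl

theorem measurePreserving_tripleEquiv : MeasurePreserving tripleEquiv volume volume := by
  refine MeasurePreserving.trans (μb := volume) ?_
    (volume_preserving_piFinSuccAbove (fun _ : Fin 3 => ℝ) 0).symm
  exact (MeasurePreserving.id volume).prod (volume_preserving_finTwoArrow ℝ).symm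

theorem diagonalCoord_eq (y : ℝ × ℝ × ℝ) :
    diagonalCoord y = Matrix.toLin' diagonalFrame (tripleEquiv y) := by
  rw [tripleEquiv_apply]
  funext i
  fin_cases i <;>
    simp [diagonalFrame, diagonalCoord, Matrix.mulVec, dotProduct, Fin.sum_univ_three] <;> ring

theorem measurable_diagonalCoord : Measurable diagonalCoord := by
  have : diagonalCoord = Matrix.toLin' diagonalFrame ∘ tripleEquiv := funext diagonalCoord_eq
  rw [this]
  exact ((LinearMap.continuous_of_finiteDimensional _).measurable).comp tripleEquiv.measurable

/-- The density is the inverse of the determinant 1/√3. It is the Jacobian in every integral of a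
tensor power below. -/
theorem map_diagonalCoord :
    Measure.map diagonalCoord volume = ENNReal.ofReal √3 • volume := by
  have : diagonalCoord = Matrix.toLin' diagonalFrame ∘ tripleEquiv := funext diagonalCoord_eq
  rw [this, ← Measure.map_map (LinearMap.continuous_of_finiteDimensional _).measurable
    tripleEquiv.measurable, measurePreserving_tripleEquiv.map_eq,
    Real.map_matrix_volume_pi_eq_smul_volume_pi (by rw [det_diagonalFrame]; positivity),
    det_diagonalFrame]
  simp [abs_of_nonneg]

/-- The threefold tensor power of `g` in the coordinates adapted to the diagonal. -/
noncomputable def tripleTensor (g : ℝ → ℂ) (y : ℝ × ℝ × ℝ) : ℂ := ∏ i, g (diagonalCoord y i)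

theorem measurable_tripleTensor {g : ℝ → ℂ} (hg : Measurable g) : Measurable (tripleTensor g) :=
  Finset.measurable_prod _ fun i _ =>
    hg.comp ((measurable_pi_apply i).comp measurable_diagonalCoord)

theorem integrable_tripleTensor {g : ℝ → ℂ} (hg : Integrable g) :
    Integrable (tripleTensor g) := by
  have h1 : Integrable (fun ξ : Fin 3 → ℝ => ∏ i, g (ξ i)) :=
    Integrable.fintype_prod (f := fun _ => g) fun _ => hg
  have h2 := h1.smul_measure (c := ENNReal.ofReal √3) (by simp)
  rw [← map_diagonalCoord] at h2
  exact (integrable_map_measure h2.aestronglyMeasurable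
    measurable_diagonalCoord.aemeasurable).1 h2

theorem integral_tripleTensor {g : ℝ → ℂ} (hm : Measurable g) :
    ∫ y, tripleTensor g y = (√3 : ℂ) * (∫ ξ, g ξ) ^ 3 := by
  have hM : Measurable (fun ξ : Fin 3 → ℝ => ∏ i, g (ξ i)) :=
    Finset.measurable_prod _ fun i _ => hm.comp (measurable_pi_apply i)
  have h := integral_map (μ := volume) measurable_diagonalCoord.aemeasurable
    (f := fun ξ : Fin 3 → ℝ => ∏ i, g (ξ i)) hM.aestronglyMeasurable
  rw [map_diagonalCoord, integral_smul_measure, integral_fintype_prod_volume_eq_pow] at h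
  rw [ENNReal.toReal_ofReal (by positivity), Fintype.card_fin, Complex.real_smul] at h
  exact h.symm

theorem lintegral_tripleTensor {g : ℝ → ℂ} (hm : Measurable g) :
    ∫⁻ y, ‖tripleTensor g y‖ₑ ^ 2 = ENNReal.ofReal √3 * (∫⁻ ξ, ‖g ξ‖ₑ ^ 2) ^ 3 := by
  have hM : Measurable (fun ξ : Fin 3 → ℝ => ∏ i, ‖g (ξ i)‖ₑ ^ 2) :=
    Finset.measurable_prod _ fun i _ => (hm.comp (measurable_pi_apply i)).enorm.pow_const 2
  have h := lintegral_map (μ := volume) hM measurable_diagonalCoord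
  rw [map_diagonalCoord, lintegral_smul_measure, smul_eq_mul] at h
  calc ∫⁻ y, ‖tripleTensor g y‖ₑ ^ 2 = ∫⁻ y, ∏ i, ‖g (diagonalCoord y i)‖ₑ ^ 2 := by
        refine lintegral_congr fun y => ?_
        simp only [tripleTensor, Fin.prod_univ_three, enorm_mul, mul_pow]
    _ = ENNReal.ofReal √3 * ∫⁻ ξ : Fin 3 → ℝ, ∏ i, ‖g (ξ i)‖ₑ ^ 2 := h.symm
    _ = _ := by
        congr 1
        rw [← measurePreserving_tripleEquiv.lintegral_comp hM]
        have e : ∀ y : ℝ × ℝ × ℝ, ∏ i, ‖g (tripleEquiv y i)‖ₑ ^ 2 =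
            ‖g y.1‖ₑ ^ 2 * (‖g y.2.1‖ₑ ^ 2 * ‖g y.2.2‖ₑ ^ 2) := by
          intro y
          rw [tripleEquiv_apply]
          simp [Fin.prod_univ_three, mul_assoc]
        simp_rw [e]
        have hg2 : AEMeasurable (fun ξ => ‖g ξ‖ₑ ^ 2) volume := by fun_prop
        have h2 : ∫⁻ z : ℝ × ℝ, ‖g z.1‖ₑ ^ 2 * ‖g z.2‖ₑ ^ 2 = (∫⁻ ξ, ‖g ξ‖ₑ ^ 2) ^ 2 := by
          rw [sq]
          exact lintegral_prod_mul hg2 hg2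
        have h3 := lintegral_prod_mul (μ := (volume : Measure ℝ)) (ν := (volume : Measure (ℝ × ℝ)))
          hg2 (g := fun z => ‖g z.1‖ₑ ^ 2 * ‖g z.2‖ₑ ^ 2) (by fun_prop)
        rw [h2, ← pow_succ'] at h3
        exact h3

/-! ### The cube of the free evolution and the Strichartz inequality. -/

theorem norm_schrodingerSymbol (r ξ : ℝ) : ‖schrodingerSymbol r ξ‖ = 1 := by
  have h : -(Complex.I * (r : ℂ) * ((2 * Real.pi * ξ) ^ 2 : ℝ)) =
      ((-(r * (2 * Real.pi * ξ) ^ 2) : ℝ) : ℂ) * Complex.I := by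
    push_cast
    ring
  rw [schrodingerSymbol, h, Complex.norm_exp_ofReal_mul_I]

/-- The Fourier integral of the free Schrödinger evolution with Fourier data `g`. -/
noncomputable def freeEvolution (g : ℝ → ℂ) (r x : ℝ) : ℂ :=
  𝓕⁻ (fun ξ => schrodingerSymbol r ξ * g ξ) x

theorem continuous_schrodingerSymbol (r : ℝ) : Continuous (schrodingerSymbol r) := by
  unfold schrodingerSymbol
  fun_prop

theorem integrable_schrodingerSymbol_mul {g : ℝ → ℂ} (hg : Integrable g) (r : ℝ) :
    Integrable (fun ξ => schrodingerSymbol r ξ * g ξ) :=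
  hg.bdd_mul (c := 1) (continuous_schrodingerSymbol r).aestronglyMeasurable
    (Filter.Eventually.of_forall fun ξ => (norm_schrodingerSymbol r ξ).le)

/-- The planar integral in the cube of the free evolution. -/
noncomputable def planarPhaseIntegral (g : ℝ → ℂ) (r σ : ℝ) : ℂ :=
  ∫ z : ℝ × ℝ, Complex.exp (-(Complex.I * (r : ℂ) *
    ((2 * Real.pi) ^ 2 * (z.1 ^ 2 + z.2 ^ 2) : ℝ))) * tripleTensor g (σ, z)

theorem measurable_planarPhaseIntegral {g : ℝ → ℂ} (hg : Measurable g) :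
    Measurable (fun p : ℝ × ℝ => planarPhaseIntegral g p.1 p.2) := by
  refine (StronglyMeasurable.integral_prod_right (f := fun (p : ℝ × ℝ) (z : ℝ × ℝ) =>
    Complex.exp (-(Complex.I * (p.1 : ℂ) *
    ((2 * Real.pi) ^ 2 * (z.1 ^ 2 + z.2 ^ 2) : ℝ))) * tripleTensor g (p.2, z)) ?_).measurable
  apply Measurable.stronglyMeasurable
  apply Measurable.mul
  · apply Continuous.measurable
    fun_prop
  · exact (measurable_tripleTensor hg).comp (by fun_prop)

/-- The Fourier data of the cube of the free evolution at time `r`. -/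
noncomputable def cubeFourierData (g : ℝ → ℂ) (r σ : ℝ) : ℂ :=
  (1 / √3 : ℝ) * (Complex.exp (-(Complex.I * (r : ℂ) * ((2 * Real.pi) ^ 2 * (σ ^ 2 / 3) : ℝ))) *
    planarPhaseIntegral g r σ)

theorem tripleTensor_fourier_phase (g : ℝ → ℂ) (r x : ℝ) (y : ℝ × ℝ × ℝ) :
    tripleTensor (fun ξ => Complex.exp (↑(2 * Real.pi * inner ℝ ξ x) * Complex.I) •
      (schrodingerSymbol r ξ * g ξ)) y =
    Complex.exp (↑(2 * Real.pi * inner ℝ y.1 x) * Complex.I) *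
      (Complex.exp (-(Complex.I * (r : ℂ) * ((2 * Real.pi) ^ 2 * (y.1 ^ 2 / 3) : ℝ))) *
      (Complex.exp (-(Complex.I * (r : ℂ) *
        ((2 * Real.pi) ^ 2 * (y.2.1 ^ 2 + y.2.2 ^ 2) : ℝ))) * tripleTensor g y)) := by
  simp only [tripleTensor, Fin.prod_univ_three, schrodingerSymbol, smul_eq_mul]
  set ξ := diagonalCoord y
  have h1 : ξ 0 + ξ 1 + ξ 2 = y.1 := sum_diagonalCoord y
  have h2 : ξ 0 ^ 2 + ξ 1 ^ 2 + ξ 2 ^ 2 = y.1 ^ 2 / 3 + (y.2.1 ^ 2 + y.2.2 ^ 2) :=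
    sum_sq_diagonalCoord y
  have h1' : (ξ 0 + ξ 1 + ξ 2 : ℂ) = y.1 := by exact_mod_cast congrArg Complex.ofReal h1
  have h2' : (ξ 0 ^ 2 + ξ 1 ^ 2 + ξ 2 ^ 2 : ℂ) = y.1 ^ 2 / 3 + (y.2.1 ^ 2 + y.2.2 ^ 2) := by
    exact_mod_cast congrArg Complex.ofReal h2
  simp only [RCLike.inner_apply, conj_trivial]
  have key : ∀ a b c a' b' c' A B C u v w : ℂ, a + b + c + a' + b' + c' = A + B + C →
      (Complex.exp a * (Complex.exp a' * u)) * (Complex.exp b * (Complex.exp b' * v)) *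
        (Complex.exp c * (Complex.exp c' * w)) =
      Complex.exp A * (Complex.exp B * (Complex.exp C * (u * v * w))) := by
    intro a b c a' b' c' A B C u v w h
    have := congrArg Complex.exp h
    simp only [Complex.exp_add] at this
    linear_combination (u * v * w) * this
  apply key
  push_cast
  linear_combination (2 * Real.pi * x * Complex.I) * h1' -
    (Complex.I * r * (2 * Real.pi) ^ 2) * h2'

theorem norm_cexp_phase (r s : ℝ) : ‖Complex.exp (-(Complex.I * (r : ℂ) * (s : ℝ)))‖ = 1 := by
  rw [Complex.norm_exp]
  simp

theorem integrable_planarPhase {g : ℝ → ℂ} (hg : Integrable g) (r : ℝ) :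
    Integrable (fun y : ℝ × ℝ × ℝ => Complex.exp (-(Complex.I * (r : ℂ) *
        ((2 * Real.pi) ^ 2 * (y.2.1 ^ 2 + y.2.2 ^ 2) : ℝ))) * tripleTensor g y) := by
  refine (integrable_tripleTensor hg).bdd_mul (c := 1) ?_ ?_
  · apply Continuous.aestronglyMeasurable
    fun_prop
  · exact Filter.Eventually.of_forall fun y => (norm_cexp_phase _ _).le

theorem integrable_cubeFourierData {g : ℝ → ℂ} (hg : Integrable g) (r : ℝ) :
    Integrable (cubeFourierData g r) := by
  refine Integrable.const_mul ?_ _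
  refine Integrable.bdd_mul (c := 1) (integrable_planarPhase hg r).integral_prod_left ?_ ?_
  · apply Continuous.aestronglyMeasurable
    fun_prop
  · exact Filter.Eventually.of_forall fun σ => (norm_cexp_phase _ _).le

/-- The cube is an integral over ℝ³ of a tensor power. In diagonal coordinates the Fourier character
sees only the first variable, so Fubini over the plane leaves a one-dimensional inverse Fourier
integral. The factor 1/√3 in `cubeFourierData` undoes the Jacobian. -/
theorem freeEvolution_pow_three {g : ℝ → ℂ} (hm : Measurable g) (hg : Integrable g) (r x : ℝ) :
    freeEvolution g r x ^ 3 = 𝓕⁻ (cubeFourierData g r) x := by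
  have h3 : (√3 : ℂ) ≠ 0 := by
    simp
  rw [freeEvolution, Real.fourierInv_eq', Real.fourierInv_eq']
  have hmeas : Measurable (fun ξ => Complex.exp (↑(2 * Real.pi * inner ℝ ξ x) * Complex.I) •
      (schrodingerSymbol r ξ * g ξ)) := by
    simp only [smul_eq_mul]
    apply Measurable.mul
    · apply Continuous.measurable
      fun_prop
    · exact (continuous_schrodingerSymbol r).measurable.mul hm
  have h := integral_tripleTensor hmeas
  simp_rw [tripleTensor_fourier_phase] at h
  rw [Measure.volume_eq_prod, integral_prod] at h
  · rw [eq_div_of_mul_eq h3 ((mul_comm _ _).trans h.symm), ← integral_div]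
    congr 1
    funext σ
    simp only
    rw [integral_const_mul, integral_const_mul, cubeFourierData, planarPhaseIntegral, smul_eq_mul]
    push_cast
    ring
  · rw [← Measure.volume_eq_prod]
    refine Integrable.bdd_mul (c := 1) (Integrable.bdd_mul (c := 1)
      (integrable_planarPhase hg r) ?_ ?_) ?_ ?_
    · apply Continuous.aestronglyMeasurable
      fun_prop
    · exact Filter.Eventually.of_forall fun σ => (norm_cexp_phase _ _).le
    · apply Continuous.aestronglyMeasurable
      fun_prop
    · exact Filter.Eventually.of_forall fun σ => (Complex.norm_exp_ofReal_mul_I _).le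

/-- The sharp one-dimensional Strichartz inequality. -/
theorem lintegral_freeEvolution_pow_six_le {g : ℝ → ℂ} (hm : Measurable g) (hg : Integrable g) :
    ∫⁻ r, ∫⁻ x, ‖freeEvolution g r x‖ₑ ^ 6 ≤
      ENNReal.ofReal (1 / (2 * √3)) * (∫⁻ ξ, ‖g ξ‖ₑ ^ 2) ^ 3 := by
  have h1 : ∀ r, ∫⁻ x, ‖freeEvolution g r x‖ₑ ^ 6 ≤
      ∫⁻ σ, ENNReal.ofReal (1 / 3) * ‖planarPhaseIntegral g r σ‖ₑ ^ 2 := by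
    intro r
    calc ∫⁻ x, ‖freeEvolution g r x‖ₑ ^ 6 = ∫⁻ x, ‖𝓕⁻ (cubeFourierData g r) x‖ₑ ^ 2 := by
          refine lintegral_congr fun x => ?_
          rw [← freeEvolution_pow_three hm hg, enorm_pow, ← pow_mul]
      _ ≤ ∫⁻ σ, ‖cubeFourierData g r σ‖ₑ ^ 2 :=
          lintegral_fourierInv_sq_le (integrable_cubeFourierData hg r)
      _ = _ := by
          refine lintegral_congr fun σ => ?_
          rw [cubeFourierData, enorm_mul, enorm_mul, mul_pow, mul_pow,
            ← ofReal_norm (Complex.exp _), norm_cexp_phase, ← ofReal_norm (Complex.ofReal _),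
            Complex.norm_real, Real.norm_of_nonneg (by positivity),
            ← ENNReal.ofReal_pow (by positivity)]
          simp
  have hae : ∀ᵐ σ : ℝ, Integrable (fun z : ℝ × ℝ => tripleTensor g (σ, z)) := by
    have := integrable_tripleTensor hg
    rw [Measure.volume_eq_prod] at this
    exact this.prod_right_ae
  calc ∫⁻ r, ∫⁻ x, ‖freeEvolution g r x‖ₑ ^ 6
      ≤ ∫⁻ r, ∫⁻ σ, ENNReal.ofReal (1 / 3) * ‖planarPhaseIntegral g r σ‖ₑ ^ 2 := lintegral_mono h1
    -- Tonelli puts the time integral inside, at fixed σ, where the planar estimate applies for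
    -- almost every σ.
    _ = ∫⁻ σ, ∫⁻ r, ENNReal.ofReal (1 / 3) * ‖planarPhaseIntegral g r σ‖ₑ ^ 2 := by
        refine lintegral_lintegral_swap ?_
        exact (((measurable_planarPhaseIntegral hm).enorm.pow_const 2).const_mul _).aemeasurable
    _ ≤ ∫⁻ σ, ENNReal.ofReal (1 / 3) * (ENNReal.ofReal (1 / 2) *
          ∫⁻ z, ‖tripleTensor g (σ, z)‖ₑ ^ 2) := by
        refine lintegral_mono_ae ?_
        filter_upwards [hae] with σ hσ
        rw [lintegral_const_mul' _ _ (by simp)]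
        gcongr
        exact lintegral_planar_sq_le _
          ((measurable_tripleTensor hm).comp measurable_prodMk_left) hσ
    _ = ENNReal.ofReal (1 / 3) * (ENNReal.ofReal (1 / 2) *
          ∫⁻ y, ‖tripleTensor g y‖ₑ ^ 2) := by
        rw [lintegral_const_mul' _ _ (by simp), lintegral_const_mul' _ _ (by simp)]
        congr 2
        exact (lintegral_prod _
          ((measurable_tripleTensor hm).enorm.pow_const 2).aemeasurable).symm
    _ = _ := by
        rw [lintegral_tripleTensor hm, ← mul_assoc, ← mul_assoc,
          ← ENNReal.ofReal_mul (by positivity), ← ENNReal.ofReal_mul (by positivity)]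
        congr 2
        -- The constant is (1/3)(1/2)√3 = 1/(2√3).
        have h3 : √3 * √3 = 3 := Real.mul_self_sqrt (by norm_num)
        field_simp
        linear_combination h3


/-! ### Weak derivatives on the Fourier side and the Gagliardo-Nirenberg inequality. -/

open scoped LineDeriv in
theorem HasWeakDeriv.fourier_ae_eq {f g : L2} (h : HasWeakDeriv f g) :
    ((𝓕 g : L2) : ℝ → ℂ) =ᵐ[volume]
      fun ξ => (2 * Real.pi * Complex.I * ξ) * ((𝓕 f : L2) : ℝ → ℂ) ξ := by
  have h1 : ∂_{(1 : ℝ)} (f : 𝓢'(ℝ, ℂ)) = (g : 𝓢'(ℝ, ℂ)) := h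
  have h2 : ((𝓕 g : L2) : 𝓢'(ℝ, ℂ)) = (2 * Real.pi * Complex.I) •
      TemperedDistribution.smulLeftCLM ℂ (fun ξ : ℝ => ((inner ℝ ξ (1 : ℝ) : ℝ) : ℂ))
        ((𝓕 f : L2) : 𝓢'(ℝ, ℂ)) := by
    rw [← Lp.fourier_toTemperedDistribution_eq, ← h1, TemperedDistribution.fourier_lineDerivOp_eq,
      Lp.fourier_toTemperedDistribution_eq]
  have hloc : LocallyIntegrable ((𝓕 f : L2) : ℝ → ℂ) :=
    (Lp.memLp _).locallyIntegrable (by norm_num)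
  have hloc' : LocallyIntegrable
      (fun ξ : ℝ => (2 * Real.pi * Complex.I * ξ) * ((𝓕 f : L2) : ℝ → ℂ) ξ) := by
    rw [← locallyIntegrableOn_univ] at hloc ⊢
    exact hloc.continuousOn_mul (by fun_prop) isOpen_univ.isLocallyClosed
  refine ae_eq_of_integral_contDiff_smul_eq ((Lp.memLp _).locallyIntegrable (by norm_num))
    hloc' ?_
  intro φ hφ hφc
  have h3 : HasCompactSupport (Complex.ofRealCLM ∘ φ) := hφc.comp_left rfl
  set ψ : 𝓢(ℝ, ℂ) := h3.toSchwartzMap (Complex.ofRealCLM.contDiff.comp hφ) with hψ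
  have hψe : ∀ x, ψ x = (φ x : ℂ) := fun x => rfl
  have key := congrArg (fun T : 𝓢'(ℝ, ℂ) => T ψ) h2
  simp only [Lp.toTemperedDistribution_apply] at key
  have hrhs : ((2 * Real.pi * Complex.I) •
      TemperedDistribution.smulLeftCLM ℂ (fun ξ : ℝ => ((inner ℝ ξ (1 : ℝ) : ℝ) : ℂ))
        ((𝓕 f : L2) : 𝓢'(ℝ, ℂ))) ψ = (2 * Real.pi * Complex.I) •
      ∫ ξ, (SchwartzMap.smulLeftCLM ℂ (fun ξ : ℝ => ((inner ℝ ξ (1 : ℝ) : ℝ) : ℂ)) ψ) ξ •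
        ((𝓕 f : L2) : ℝ → ℂ) ξ := by
    rw [← Lp.toTemperedDistribution_apply]
    rfl
  rw [hrhs, ← integral_smul] at key
  calc ∫ x, φ x • ((𝓕 g : L2) : ℝ → ℂ) x = ∫ x, ψ x • ((𝓕 g : L2) : ℝ → ℂ) x := by
        simp only [hψe]; rfl
    _ = _ := key
    _ = _ := by
        refine integral_congr_ae (Filter.Eventually.of_forall fun ξ => ?_)
        simp only
        rw [SchwartzMap.smulLeftCLM_apply_apply (by fun_prop)]
        simp only [hψe, smul_eq_mul, RCLike.inner_apply, conj_trivial, Complex.real_smul]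
        push_cast
        ring

theorem enorm_fourier_eq (f : L2) : ‖(𝓕 f : L2)‖ₑ = ‖f‖ₑ :=
  enorm_eq_iff_norm_eq.2 (Lp.norm_fourier_eq f)

theorem lintegral_enorm_fourier_sq (f : L2) :
    ∫⁻ ξ, ‖((𝓕 f : L2) : ℝ → ℂ) ξ‖ₑ ^ 2 = ‖f‖ₑ ^ 2 := by
  rw [lintegral_enorm_sq_eq, enorm_fourier_eq]

theorem HasWeakDeriv.lintegral_fourier {f g : L2} (h : HasWeakDeriv f g) :
    ∫⁻ ξ, ENNReal.ofReal ((2 * Real.pi * ξ) ^ 2) * ‖((𝓕 f : L2) : ℝ → ℂ) ξ‖ₑ ^ 2 =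
      ‖g‖ₑ ^ 2 := by
  rw [← lintegral_enorm_fourier_sq]
  refine lintegral_congr_ae ?_
  filter_upwards [h.fourier_ae_eq] with ξ hξ
  rw [hξ, enorm_mul, mul_pow ‖(2 * (Real.pi : ℂ) * Complex.I * (ξ : ℂ))‖ₑ]
  congr 1
  rw [← ofReal_norm, ← ENNReal.ofReal_pow (norm_nonneg _)]
  congr 1
  simp [mul_pow]

/-- If g = 0, the Fourier transform of f vanishes off the null set ξ = 0. This keeps the denominator
of the quotient positive. -/
theorem HasWeakDeriv.ne_zero {f g : L2} (h : HasWeakDeriv f g) (hf : f ≠ 0) : g ≠ 0 := by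
  rintro rfl
  apply hf
  have h0 := h.lintegral_fourier
  rw [enorm_zero, zero_pow two_ne_zero, lintegral_eq_zero_iff' (by fun_prop)] at h0
  have h1 : ∀ᵐ ξ : ℝ, ξ ≠ 0 := by simp [ae_iff]
  have h2 : (𝓕 f : L2) = 0 := by
    rw [Lp.eq_zero_iff_ae_eq_zero]
    filter_upwards [h0, h1] with ξ hξ hξ0
    have hpos : 0 < (2 * Real.pi * ξ) ^ 2 := by positivity
    simpa [hpos, hξ0] using hξ
  have h3 : ‖(𝓕 f : L2)‖ = ‖f‖ := Lp.norm_fourier_eq f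
  rw [h2, norm_zero] at h3
  exact norm_eq_zero.1 h3.symm

theorem lintegral_inv_resolvent {l : ℝ} (hl : 0 < l) :
    ∫⁻ ξ : ℝ, ENNReal.ofReal ((l ^ 2 + (2 * Real.pi * ξ) ^ 2)⁻¹) =
      ENNReal.ofReal (1 / (2 * l)) := by
  have hpi := Real.pi_pos
  have e : ∀ ξ : ℝ, (l ^ 2 + (2 * Real.pi * ξ) ^ 2)⁻¹ =
      (l ^ 2)⁻¹ * (1 + (2 * Real.pi / l * ξ) ^ 2)⁻¹ := by
    intro ξ
    rw [← mul_inv]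
    congr 1
    field_simp
  simp_rw [e]
  rw [← ofReal_integral_eq_lintegral_ofReal]
  · rw [integral_const_mul, Measure.integral_comp_mul_left (fun x : ℝ => (1 + x ^ 2)⁻¹),
      integral_univ_inv_one_add_sq, abs_of_pos (by positivity)]
    congr 1
    simp only [smul_eq_mul]
    field_simp
  · exact (integrable_inv_one_add_sq.comp_mul_left' (by positivity)).const_mul _
  · exact Filter.Eventually.of_forall fun ξ => by positivity

/-- The sharp Gagliardo-Nirenberg inequality on the Fourier side. -/
theorem HasWeakDeriv.sq_lintegral_fourier_le {f g : L2} (h : HasWeakDeriv f g) (hf : f ≠ 0) :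
    (∫⁻ ξ, ‖((𝓕 f : L2) : ℝ → ℂ) ξ‖ₑ) ^ 2 ≤ ENNReal.ofReal (‖f‖ * ‖g‖) := by
  have ha : 0 < ‖f‖ := norm_pos_iff.2 hf
  have hb : 0 < ‖g‖ := norm_pos_iff.2 (h.ne_zero hf)
  -- Cauchy-Schwarz with weight l² + (2πξ)² gives the bound (l²‖f‖² + ‖g‖²)/(2l), which is smallest,
  -- and equal to ‖f‖‖g‖, for this l.
  set l := ‖g‖ / ‖f‖ with hl
  have hl0 : 0 < l := by positivity
  set F : ℝ → ℂ := ((𝓕 f : L2) : ℝ → ℂ)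
  have hF : AEMeasurable (fun ξ => ‖F ξ‖ₑ) := by fun_prop
  set w : ℝ → ℝ := fun ξ => l ^ 2 + (2 * Real.pi * ξ) ^ 2 with hw
  have hw0 : ∀ ξ, 0 < w ξ := fun ξ => by positivity
  calc (∫⁻ ξ, ‖F ξ‖ₑ) ^ 2
      = (∫⁻ ξ, ENNReal.ofReal (√(w ξ))⁻¹ * (ENNReal.ofReal √(w ξ) * ‖F ξ‖ₑ)) ^ 2 := by
        congr 2
        funext ξ
        have := hw0 ξ
        rw [← mul_assoc, ← ENNReal.ofReal_mul (by positivity),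
          inv_mul_cancel₀ (by positivity), ENNReal.ofReal_one, one_mul]
    _ ≤ (∫⁻ ξ, ENNReal.ofReal (√(w ξ))⁻¹ ^ 2) *
          ∫⁻ ξ, (ENNReal.ofReal √(w ξ) * ‖F ξ‖ₑ) ^ 2 := by
        apply lintegral_mul_sq_le
        · apply Measurable.aemeasurable
          fun_prop
        · apply AEMeasurable.mul _ hF
          apply Measurable.aemeasurable
          fun_prop
    _ = ENNReal.ofReal (1 / (2 * l)) *
          ∫⁻ ξ, (ENNReal.ofReal (l ^ 2) * ‖F ξ‖ₑ ^ 2 +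
            ENNReal.ofReal ((2 * Real.pi * ξ) ^ 2) * ‖F ξ‖ₑ ^ 2) := by
        rw [← lintegral_inv_resolvent hl0]
        congr 1
        · refine lintegral_congr fun ξ => ?_
          rw [← ENNReal.ofReal_pow (by positivity), inv_pow, Real.sq_sqrt (hw0 ξ).le]
        · refine lintegral_congr fun ξ => ?_
          rw [mul_pow, ← ENNReal.ofReal_pow (by positivity), Real.sq_sqrt (hw0 ξ).le, hw,
            ENNReal.ofReal_add (by positivity) (by positivity), add_mul]
    _ = ENNReal.ofReal (1 / (2 * l)) * (ENNReal.ofReal (l ^ 2) * ‖f‖ₑ ^ 2 + ‖g‖ₑ ^ 2) := by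
        rw [lintegral_add_left' ((hF.pow_const 2).const_mul _), h.lintegral_fourier,
          lintegral_const_mul' _ _ (by simp), lintegral_enorm_fourier_sq]
    _ = ENNReal.ofReal (‖f‖ * ‖g‖) := by
        rw [← ofReal_norm, ← ofReal_norm, ← ENNReal.ofReal_pow (by positivity),
          ← ENNReal.ofReal_pow (by positivity), ← ENNReal.ofReal_mul (by positivity),
          ← ENNReal.ofReal_add (by positivity) (by positivity),
          ← ENNReal.ofReal_mul (by positivity)]
        congr 1
        rw [hl]
        field_simp
        norm_num

theorem HasWeakDeriv.integrable_fourier {f g : L2} (h : HasWeakDeriv f g) :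
    Integrable ((𝓕 f : L2) : ℝ → ℂ) := by
  rcases eq_or_ne f 0 with rfl | hf
  · have h2 : (𝓕 (0 : L2) : L2) = 0 := (Lp.fourierTransformₗᵢ ℝ ℂ).map_zero
    rw [h2]
    exact (integrable_zero ℝ ℂ volume).congr (Lp.coeFn_zero ℂ 2 volume).symm
  refine ⟨(Lp.memLp _).1, ?_⟩
  have := (h.sq_lintegral_fourier_le hf).trans_lt ENNReal.ofReal_lt_top
  rwa [ENNReal.pow_lt_top_iff, or_iff_left two_ne_zero] at this

/-! ### From the propagator to the upper bound. -/

theorem propagator_ae_eq {f : L2} (hf : Integrable ((𝓕 f : L2) : ℝ → ℂ)) (r : ℝ) :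
    (propagator r f : ℝ → ℂ) =ᵐ[volume] freeEvolution (𝓕 f : L2) r := by
  set s : Lp ℂ ∞ (volume : Measure ℝ) := (memLp_schrodingerSymbol r).toLp _
  have hs : ((s • 𝓕 f : L2) : ℝ → ℂ) =ᵐ[volume]
      fun ξ => schrodingerSymbol r ξ * ((𝓕 f : L2) : ℝ → ℂ) ξ := by
    filter_upwards [Lp.coeFn_lpSMul (r := 2) s (𝓕 f : L2),
      (memLp_schrodingerSymbol r).coeFn_toLp] with ξ h1 h2
    rw [h1]
    simp only [Pi.smul_apply', smul_eq_mul]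
    rw [h2]
  have h1 := coeFn_fourierInv_ae_eq (s • 𝓕 f : L2)
    ((integrable_schrodingerSymbol_mul hf r).congr hs.symm)
  refine h1.trans (Filter.Eventually.of_forall fun x => ?_)
  exact Real.fourierInv_congr_ae hs x

theorem spaceTimeNormPow_eq {f : L2} (hf : Integrable ((𝓕 f : L2) : ℝ → ℂ)) (q : ℝ) :
    spaceTimeNormPow q f = ∫⁻ r, ∫⁻ x, ‖freeEvolution (𝓕 f : L2) r x‖ₑ ^ q := by
  refine lintegral_congr fun r => lintegral_congr_ae ?_
  filter_upwards [propagator_ae_eq hf r] with x hx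
  rw [hx]

theorem enorm_freeEvolution_le (g : ℝ → ℂ) (r x : ℝ) :
    ‖freeEvolution g r x‖ₑ ≤ ∫⁻ ξ, ‖g ξ‖ₑ := by
  rw [freeEvolution, Real.fourierInv_eq']
  refine (enorm_integral_le_lintegral_enorm _).trans (lintegral_mono fun ξ => le_of_eq ?_)
  rw [smul_eq_mul, enorm_mul, enorm_mul, ← ofReal_norm, ← ofReal_norm (schrodingerSymbol r ξ),
    norm_schrodingerSymbol, Complex.norm_exp_ofReal_mul_I]
  simp

theorem weinstein_le {p : ℝ} (hp : 5 ≤ p) (f : H1) (hf : (f : L2) ≠ 0) :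
    weinstein p f ≤ ENNReal.ofReal (1 / (2 * √3)) := by
  have h := hasWeakDeriv_weakDeriv f
  set g := weakDeriv f with hg
  have ha : 0 < ‖(f : L2)‖ := norm_pos_iff.2 hf
  have hb : 0 < ‖g‖ := norm_pos_iff.2 (h.ne_zero hf)
  have hint := h.integrable_fourier
  have hp5 : 0 ≤ p - 5 := by linarith
  refine ENNReal.div_le_of_le_mul ?_
  rw [spaceTimeNormPow_eq hint]
  set S := ∫⁻ ξ, ‖((𝓕 (f : L2) : L2) : ℝ → ℂ) ξ‖ₑ
  have hS : S ^ (p - 5) ≤ ENNReal.ofReal ((‖(f : L2)‖ * ‖g‖) ^ ((p - 5) / 2)) := by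
    calc S ^ (p - 5) = (S ^ 2) ^ ((p - 5) / 2) := by
          rw [← ENNReal.rpow_natCast, ← ENNReal.rpow_mul]
          congr 1
          push_cast
          ring
      _ ≤ ENNReal.ofReal (‖(f : L2)‖ * ‖g‖) ^ ((p - 5) / 2) :=
          ENNReal.rpow_le_rpow (h.sq_lintegral_fourier_le hf) (by positivity)
      _ = _ := ENNReal.ofReal_rpow_of_nonneg (by positivity) (by positivity)
  have hStop : S ^ (p - 5) ≠ ∞ := (hS.trans_lt ENNReal.ofReal_lt_top).ne
  calc ∫⁻ r, ∫⁻ x, ‖freeEvolution (𝓕 (f : L2) : L2) r x‖ₑ ^ (p + 1)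
      ≤ ∫⁻ r, ∫⁻ x, S ^ (p - 5) * ‖freeEvolution (𝓕 (f : L2) : L2) r x‖ₑ ^ 6 := by
        refine lintegral_mono fun r => lintegral_mono fun x => ?_
        -- Six powers are kept for Strichartz; the remaining p - 5 ≥ 0 are bounded uniformly by `S`.
        have e : p + 1 = (p - 5) + (6 : ℕ) := by
          push_cast
          ring
        rw [e, ENNReal.rpow_add_of_nonneg _ _ hp5 (by positivity), ENNReal.rpow_natCast]
        gcongr
        exact enorm_freeEvolution_le _ _ _
    _ = S ^ (p - 5) * ∫⁻ r, ∫⁻ x, ‖freeEvolution (𝓕 (f : L2) : L2) r x‖ₑ ^ 6 := by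
        rw [← lintegral_const_mul' _ _ hStop]
        simp_rw [lintegral_const_mul' _ _ hStop]
    _ ≤ ENNReal.ofReal ((‖(f : L2)‖ * ‖g‖) ^ ((p - 5) / 2)) *
          (ENNReal.ofReal (1 / (2 * √3)) * (‖(f : L2)‖ₑ ^ 2) ^ 3) := by
        rw [← lintegral_enorm_fourier_sq]
        gcongr
        exact lintegral_freeEvolution_pow_six_le (Lp.stronglyMeasurable _).measurable hint
    _ = _ := by
        rw [← ofReal_norm, ← pow_mul, ← ENNReal.ofReal_pow (by positivity),
          ← ENNReal.ofReal_mul (by positivity), ← ENNReal.ofReal_mul (by positivity),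
          ← ENNReal.ofReal_mul (by positivity)]
        congr 1
        have e : (p + 7) / 2 = (p - 5) / 2 + (6 : ℕ) := by
          push_cast
          ring
        rw [e, Real.rpow_add_natCast ha.ne', Real.mul_rpow ha.le hb.le]
        ring

theorem sharpConst_le {p : ℝ} (hp : 5 ≤ p) :
    sharpConst p ≤ ENNReal.ofReal (1 / (2 * √3)) :=
  iSup₂_le fun f hf => weinstein_le hp f hf


/-! ### Gaussian and beta integrals. -/

theorem lintegral_gaussian {b : ℝ} (hb : 0 < b) :
    ∫⁻ x : ℝ, ENNReal.ofReal (Real.exp (-b * x ^ 2)) = ENNReal.ofReal √(Real.pi / b) := by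
  rw [← integral_gaussian, ofReal_integral_eq_lintegral_ofReal (integrable_exp_neg_mul_sq hb)]
  exact Filter.Eventually.of_forall fun x => (Real.exp_pos _).le

theorem lintegral_sq_mul_gaussian {b : ℝ} (hb : 0 < b) :
    ∫⁻ x : ℝ, ENNReal.ofReal (x ^ 2 * Real.exp (-b * x ^ 2)) =
      ENNReal.ofReal (√(Real.pi / b) / (2 * b)) := by
  have hint : Integrable (fun x : ℝ => x ^ 2 * Real.exp (-b * x ^ 2)) := by
    have := integrable_rpow_mul_exp_neg_mul_sq hb (s := 2) (by norm_num)
    simpa using this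
  rw [← ofReal_integral_eq_lintegral_ofReal hint
    (Filter.Eventually.of_forall fun x => by positivity)]
  congr 1
  have h1 := integral_comp_abs (f := fun x : ℝ => x ^ 2 * Real.exp (-b * x ^ 2))
  simp only [sq_abs] at h1
  have h2 := integral_rpow_mul_exp_neg_mul_rpow (p := 2) (q := 2) two_pos (by norm_num) hb
  simp only [Real.rpow_two] at h2
  have h3 : Real.Gamma ((2 + 1) / 2) = √Real.pi / 2 := by
    rw [show ((2 : ℝ) + 1) / 2 = 1 / 2 + 1 by norm_num, Real.Gamma_add_one (by norm_num),
      Real.Gamma_one_half_eq]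
    ring
  have h4 : b ^ (-((2 : ℝ) + 1) / 2) = 1 / (b * √b) := by
    rw [show (-((2 : ℝ) + 1) / 2) = -(1 + 1 / 2) by norm_num, Real.rpow_neg hb.le,
      Real.rpow_add hb, Real.rpow_one, ← Real.sqrt_eq_rpow, one_div]
  rw [h1, h2, h3, h4, Real.sqrt_div Real.pi_pos.le]
  field_simp

/-- The power is a Gamma integral in t of exp(-(1 + y²)t). After Tonelli the y-integral is Gaussian
and gives √(π/t), which lowers the Gamma exponent by 1/2. -/
theorem lintegral_one_add_sq_rpow_neg {s : ℝ} (hs : 1 / 2 < s) :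
    ∫⁻ y : ℝ, ENNReal.ofReal ((1 + y ^ 2) ^ (-s)) =
      ENNReal.ofReal (√Real.pi * Real.Gamma (s - 1 / 2) / Real.Gamma s) := by
  have hs0 : 0 < s := by linarith
  have hs1 : 0 < s - 1 / 2 := by linarith
  have hG : 0 < Real.Gamma s := Real.Gamma_pos_of_pos hs0
  have gammaInt : ∀ {a r : ℝ}, 0 < a → 0 < r →
      ∫⁻ t in Set.Ioi (0 : ℝ), ENNReal.ofReal (t ^ (a - 1) * Real.exp (-(r * t))) =
        ENNReal.ofReal ((1 / r) ^ a * Real.Gamma a) := by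
    intro a r ha hr
    rw [← Real.integral_rpow_mul_exp_neg_mul_Ioi ha hr, ofReal_integral_eq_lintegral_ofReal]
    -- The Bochner integral of a non-integrable function is 0, while this one is positive.
    · apply Integrable.of_integral_ne_zero
      rw [Real.integral_rpow_mul_exp_neg_mul_Ioi ha hr]
      have := Real.Gamma_pos_of_pos ha
      positivity
    · refine (ae_restrict_iff' measurableSet_Ioi).2 (Filter.Eventually.of_forall fun t ht => ?_)
      have ht' : (0 : ℝ) < t := ht
      simp only [Pi.zero_apply]
      positivity
  have h1 : ∀ y : ℝ, ENNReal.ofReal ((1 + y ^ 2) ^ (-s)) = ENNReal.ofReal (1 / Real.Gamma s) *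
      ∫⁻ t in Set.Ioi (0 : ℝ), ENNReal.ofReal (t ^ (s - 1) * Real.exp (-((1 + y ^ 2) * t))) := by
    intro y
    rw [gammaInt hs0 (by positivity), ← ENNReal.ofReal_mul (by positivity),
      Real.rpow_neg (by positivity), one_div (1 + y ^ 2), Real.inv_rpow (by positivity)]
    congr 1
    field_simp
  have h2 : ∀ t ∈ Set.Ioi (0 : ℝ),
      ∫⁻ y : ℝ, ENNReal.ofReal (t ^ (s - 1) * Real.exp (-((1 + y ^ 2) * t))) =
        ENNReal.ofReal √Real.pi * ENNReal.ofReal (t ^ (s - 1 / 2 - 1) * Real.exp (-(1 * t))) := by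
    intro t ht
    have ht' : (0 : ℝ) < t := ht
    have e : ∀ y : ℝ, t ^ (s - 1) * Real.exp (-((1 + y ^ 2) * t)) =
        (t ^ (s - 1) * Real.exp (-t)) * Real.exp (-t * y ^ 2) := by
      intro y
      rw [mul_assoc, ← Real.exp_add]
      congr 2
      ring
    simp_rw [e]
    simp_rw [ENNReal.ofReal_mul (show 0 ≤ t ^ (s - 1) * Real.exp (-t) by positivity)]
    rw [lintegral_const_mul' _ _ (by simp), lintegral_gaussian ht',
      ← ENNReal.ofReal_mul (by positivity), ← ENNReal.ofReal_mul (by positivity)]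
    congr 1
    rw [Real.sqrt_div Real.pi_pos.le, show s - 1 / 2 - 1 = (s - 1) - 1 / 2 by ring,
      Real.rpow_sub ht' (s - 1) (1 / 2), ← Real.sqrt_eq_rpow, one_mul]
    ring
  simp_rw [h1]
  rw [lintegral_const_mul' _ _ (by simp), lintegral_lintegral_swap,
    setLIntegral_congr_fun measurableSet_Ioi h2, lintegral_const_mul' _ _ (by simp),
    gammaInt hs1 one_pos, ← ENNReal.ofReal_mul (by positivity),
    ← ENNReal.ofReal_mul (by positivity)]
  · congr 1
    simp
    ring
  · apply Measurable.aemeasurable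
    simp only [Function.uncurry_def]
    fun_prop

/-! ### The Gaussian test function and the lower bound. -/

/-- The Gaussian `e^{-πξ²}`. -/
noncomputable def gaussianData (ξ : ℝ) : ℂ := ((Real.exp (-Real.pi * ξ ^ 2) : ℝ) : ℂ)

theorem continuous_gaussianData : Continuous gaussianData := by
  unfold gaussianData
  fun_prop

theorem norm_gaussianData (ξ : ℝ) : ‖gaussianData ξ‖ = Real.exp (-Real.pi * ξ ^ 2) := by
  rw [gaussianData, Complex.norm_real, Real.norm_of_nonneg (Real.exp_pos _).le]

theorem norm_gaussianData_sq (ξ : ℝ) :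
    ‖gaussianData ξ‖ ^ 2 = Real.exp (-(2 * Real.pi) * ξ ^ 2) := by
  rw [norm_gaussianData, ← Real.exp_nat_mul]
  congr 1
  push_cast
  ring

theorem memLp_gaussianData : MemLp gaussianData 2 := by
  rw [memLp_two_iff_integrable_sq_norm continuous_gaussianData.aestronglyMeasurable]
  simp_rw [norm_gaussianData_sq]
  exact integrable_exp_neg_mul_sq (by positivity)

/-- The weight is the Bessel symbol of order 1; this function witnesses membership in H¹. -/
theorem memLp_weighted_gaussianData :
    MemLp (fun ξ : ℝ => (((1 + ‖ξ‖ ^ 2) ^ (1 / 2 : ℝ) : ℝ) : ℂ) * gaussianData ξ) 2 := by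
  rw [memLp_two_iff_integrable_sq_norm]
  · have e : ∀ ξ : ℝ, ‖(((1 + ‖ξ‖ ^ 2) ^ (1 / 2 : ℝ) : ℝ) : ℂ) * gaussianData ξ‖ ^ 2 =
        Real.exp (-(2 * Real.pi) * ξ ^ 2) + ξ ^ 2 * Real.exp (-(2 * Real.pi) * ξ ^ 2) := by
      intro ξ
      rw [norm_mul, mul_pow, norm_gaussianData_sq, Complex.norm_real,
        Real.norm_of_nonneg (by positivity), ← Real.sqrt_eq_rpow, Real.sq_sqrt (by positivity)]
      simp
      ring
    simp_rw [e]
    have h1 : Integrable (fun x : ℝ => x ^ 2 * Real.exp (-(2 * Real.pi) * x ^ 2)) := by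
      have := integrable_rpow_mul_exp_neg_mul_sq (b := 2 * Real.pi) (by positivity) (s := 2)
        (by norm_num)
      simpa using this
    exact (integrable_exp_neg_mul_sq (by positivity)).add h1
  · apply Continuous.aestronglyMeasurable
    refine Continuous.mul ?_ continuous_gaussianData
    refine Complex.continuous_ofReal.comp ?_
    exact Continuous.rpow_const (by fun_prop) (fun x => Or.inr (by norm_num))

/-- The Gaussian as an element of `L²`, defined through its Fourier transform. -/
noncomputable def gaussianL2 : L2 := 𝓕⁻ (memLp_gaussianData.toLp gaussianData : L2)

theorem fourier_gaussianL2 : (𝓕 gaussianL2 : L2) = memLp_gaussianData.toLp gaussianData :=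
  FourierTransform.fourier_fourierInv_eq _

theorem fourier_gaussianL2_ae : ((𝓕 gaussianL2 : L2) : ℝ → ℂ) =ᵐ[volume] gaussianData := by
  rw [fourier_gaussianL2]
  exact memLp_gaussianData.coeFn_toLp

theorem gaussianL2_mem_H1 : gaussianL2 ∈ H1 := by
  refine TemperedDistribution.memSobolev_iff_exists_smulLeftCLM_fourier.2
    ⟨memLp_weighted_gaussianData.toLp _, ?_⟩
  rw [Lp.fourier_toTemperedDistribution_eq]
  ext φ
  rw [TemperedDistribution.smulLeftCLM_apply_apply, Lp.toTemperedDistribution_apply,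
    Lp.toTemperedDistribution_apply]
  refine integral_congr_ae ?_
  filter_upwards [fourier_gaussianL2_ae, memLp_weighted_gaussianData.coeFn_toLp] with ξ h1 h2
  rw [h1, h2, SchwartzMap.smulLeftCLM_apply_apply (by fun_prop)]
  simp only [smul_eq_mul]
  ring

theorem norm_gaussianL2 : ‖gaussianL2‖ = 2 ^ (-(1 / 4) : ℝ) := by
  have h : ‖gaussianL2‖ₑ ^ 2 = ENNReal.ofReal √(Real.pi / (2 * Real.pi)) := by
    rw [← lintegral_enorm_fourier_sq, ← lintegral_gaussian (by positivity)]
    refine lintegral_congr_ae ?_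
    filter_upwards [fourier_gaussianL2_ae] with ξ hξ
    rw [hξ, ← ofReal_norm, ← ENNReal.ofReal_pow (norm_nonneg _), norm_gaussianData_sq]
  rw [← ofReal_norm, ← ENNReal.ofReal_pow (norm_nonneg _),
    ENNReal.ofReal_eq_ofReal_iff (by positivity) (by positivity)] at h
  have e : (2 ^ (-(1 / 4) : ℝ) : ℝ) ^ 2 = √(Real.pi / (2 * Real.pi)) := by
    rw [← Real.rpow_natCast, ← Real.rpow_mul (by norm_num), Real.sqrt_eq_rpow,
      show Real.pi / (2 * Real.pi) = 2⁻¹ by field_simp, Real.inv_rpow (by norm_num),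
      ← Real.rpow_neg (by norm_num)]
    norm_num
  exact (pow_left_inj₀ (norm_nonneg _) (by positivity) two_ne_zero).1 (h.trans e.symm)

theorem norm_weakDeriv_gaussianL2 {g : L2} (hg : HasWeakDeriv gaussianL2 g) :
    ‖g‖ = Real.pi ^ (1 / 2 : ℝ) * 2 ^ (-(1 / 4) : ℝ) := by
  have hpi := Real.pi_pos
  have h : ‖g‖ₑ ^ 2 = ENNReal.ofReal (Real.pi * √(Real.pi / (2 * Real.pi))) := by
    rw [← hg.lintegral_fourier]
    calc _ = ∫⁻ ξ : ℝ, ENNReal.ofReal ((2 * Real.pi) ^ 2) *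
            ENNReal.ofReal (ξ ^ 2 * Real.exp (-(2 * Real.pi) * ξ ^ 2)) := by
          refine lintegral_congr_ae ?_
          filter_upwards [fourier_gaussianL2_ae] with ξ hξ
          rw [hξ, ← ofReal_norm, ← ENNReal.ofReal_pow (norm_nonneg _), norm_gaussianData_sq,
            ← ENNReal.ofReal_mul (by positivity), ← ENNReal.ofReal_mul (by positivity)]
          congr 1
          ring
      _ = _ := by
          rw [lintegral_const_mul' _ _ (by simp), lintegral_sq_mul_gaussian (by positivity),
            ← ENNReal.ofReal_mul (by positivity)]
          congr 1
          field_simp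
  rw [← ofReal_norm, ← ENNReal.ofReal_pow (norm_nonneg _),
    ENNReal.ofReal_eq_ofReal_iff (by positivity) (by positivity)] at h
  have e : (Real.pi ^ (1 / 2 : ℝ) * 2 ^ (-(1 / 4) : ℝ) : ℝ) ^ 2 =
      Real.pi * √(Real.pi / (2 * Real.pi)) := by
    rw [mul_pow, ← Real.sqrt_eq_rpow, Real.sq_sqrt hpi.le, ← Real.rpow_natCast,
      ← Real.rpow_mul (by norm_num), Real.sqrt_eq_rpow,
      show Real.pi / (2 * Real.pi) = 2⁻¹ by field_simp, Real.inv_rpow (by norm_num),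
      ← Real.rpow_neg (by norm_num)]
    norm_num
  exact (pow_left_inj₀ (norm_nonneg _) (by positivity) two_ne_zero).1 (h.trans e.symm)

theorem gaussianL2_ne_zero : gaussianL2 ≠ 0 := by
  rw [← norm_pos_iff, norm_gaussianL2]
  positivity

/-- The symbol turns the Gaussian into exp(-πbξ²) with b = 1 + 4πir, whose Fourier transform is
explicit. Here |b|² = 1 + (4πr)² and Re(1/b) = 1/|b|². -/
theorem norm_freeEvolution_gaussianData (r x : ℝ) :
    ‖freeEvolution gaussianData r x‖ =
      (1 + (4 * Real.pi * r) ^ 2) ^ (-(1 / 4) : ℝ) *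
        Real.exp (-(Real.pi / (1 + (4 * Real.pi * r) ^ 2)) * x ^ 2) := by
  set D : ℝ := 1 + (4 * Real.pi * r) ^ 2 with hD
  have hD0 : 0 < D := by positivity
  set b : ℂ := ⟨1, 4 * Real.pi * r⟩ with hb
  have hbre : b.re = 1 := rfl
  have hnb : Complex.normSq b = D := by
    rw [Complex.normSq_mk, hD]
    ring
  have hnorm : ‖b‖ = √D := by rw [Complex.norm_def, hnb]
  have hb0 : 0 < b.re := by simp [hbre]
  have e : (fun ξ => schrodingerSymbol r ξ * gaussianData ξ) =
      fun ξ : ℝ => Complex.exp (-Real.pi * b * ξ ^ 2) := by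
    funext ξ
    have hb' : b = 1 + (4 * Real.pi * r : ℝ) * Complex.I := by
      apply Complex.ext <;> simp [hb]
    rw [schrodingerSymbol, gaussianData, Complex.ofReal_exp, ← Complex.exp_add, hb']
    congr 1
    push_cast
    ring
  rw [freeEvolution, e, Real.fourierInv_eq_fourier_neg, fourier_gaussian_pi hb0]
  simp only
  rw [norm_mul, norm_div, norm_one, show (1 / 2 : ℂ) = ((1 / 2 : ℝ) : ℂ) by push_cast; rfl,
    Complex.norm_cpow_real, hnorm, Complex.norm_exp]
  congr 1
  · rw [Real.sqrt_eq_rpow, ← Real.rpow_mul hD0.le, one_div, ← Real.rpow_neg hD0.le]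
    norm_num
  · congr 1
    have h1 : (-(Real.pi : ℂ) / b * ((-x : ℝ) : ℂ) ^ 2) = ((-Real.pi * x ^ 2 : ℝ) : ℂ) * b⁻¹ := by
      push_cast
      ring
    rw [h1, Complex.re_ofReal_mul, Complex.inv_re, hnb, hbre]
    ring

/-- With D = 1 + (4πr)², the x-integral contributes √(D/q), so D^(-q/4) becomes q^(-1/2)
D^(-(q-2)/4). The r-integral then converges exactly when (q - 2)/4 > 1/2, that is, q > 4. -/
theorem spaceTimeNormPow_gaussianL2 {q : ℝ} (hq : 4 < q) :
    spaceTimeNormPow q gaussianL2 = ENNReal.ofReal (q ^ (-(1 / 2) : ℝ) * (1 / (4 * Real.pi)) *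
      (√Real.pi * Real.Gamma ((q - 2) / 4 - 1 / 2) / Real.Gamma ((q - 2) / 4))) := by
  have hpi := Real.pi_pos
  have hq0 : 0 < q := by linarith
  have hint : Integrable ((𝓕 gaussianL2 : L2) : ℝ → ℂ) :=
    (hasWeakDeriv_weakDeriv ⟨gaussianL2, gaussianL2_mem_H1⟩).integrable_fourier
  have hev : ∀ r x, freeEvolution (𝓕 gaussianL2 : L2) r x = freeEvolution gaussianData r x := by
    intro r x
    refine Real.fourierInv_congr_ae ?_ x
    filter_upwards [fourier_gaussianL2_ae] with ξ hξ
    rw [hξ]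
  rw [spaceTimeNormPow_eq hint]
  have h1 : ∀ r : ℝ, ∫⁻ x, ‖freeEvolution (𝓕 gaussianL2 : L2) r x‖ₑ ^ q =
      ENNReal.ofReal (q ^ (-(1 / 2) : ℝ)) *
        ENNReal.ofReal ((1 + (4 * Real.pi * r) ^ 2) ^ (-((q - 2) / 4))) := by
    intro r
    set D : ℝ := 1 + (4 * Real.pi * r) ^ 2 with hD
    have hD0 : 0 < D := by positivity
    have e : ∀ x, ‖freeEvolution (𝓕 gaussianL2 : L2) r x‖ₑ ^ q =
        ENNReal.ofReal (D ^ (-(q / 4))) * ENNReal.ofReal (Real.exp (-(Real.pi * q / D) * x ^ 2)) := by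
      intro x
      rw [hev, ← ofReal_norm, norm_freeEvolution_gaussianData, ← hD,
        ENNReal.ofReal_rpow_of_nonneg (by positivity) hq0.le, ← ENNReal.ofReal_mul (by positivity),
        Real.mul_rpow (by positivity) (by positivity), ← Real.rpow_mul hD0.le, ← Real.exp_mul]
      congr 3 <;> ring
    simp_rw [e]
    rw [lintegral_const_mul' _ _ (by simp), lintegral_gaussian (by positivity),
      ← ENNReal.ofReal_mul (by positivity), ← ENNReal.ofReal_mul (by positivity)]
    congr 1
    rw [show Real.pi / (Real.pi * q / D) = D / q by field_simp, Real.sqrt_div hD0.le,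
      Real.rpow_neg hq0.le, ← Real.sqrt_eq_rpow,
      show -((q - 2) / 4) = -(q / 4) + 1 / 2 by ring, Real.rpow_add hD0, ← Real.sqrt_eq_rpow]
    ring
  simp_rw [h1]
  have hmeas : Measurable (fun y : ℝ => ENNReal.ofReal ((1 + y ^ 2) ^ (-((q - 2) / 4)))) := by
    fun_prop
  have hscale : ∫⁻ r : ℝ, ENNReal.ofReal ((1 + (4 * Real.pi * r) ^ 2) ^ (-((q - 2) / 4))) =
      ENNReal.ofReal (1 / (4 * Real.pi)) *
        ∫⁻ y : ℝ, ENNReal.ofReal ((1 + y ^ 2) ^ (-((q - 2) / 4))) := by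
    have h2 := lintegral_map (μ := (volume : Measure ℝ)) hmeas
      (measurable_const_mul (4 * Real.pi))
    rw [Real.map_volume_mul_left (by positivity), lintegral_smul_measure] at h2
    rw [← h2, abs_of_pos (by positivity), one_div, smul_eq_mul]
  rw [lintegral_const_mul' _ _ (by simp), hscale,
    lintegral_one_add_sq_rpow_neg (by linarith), ← ENNReal.ofReal_mul (by positivity),
    ← ENNReal.ofReal_mul (by positivity)]
  congr 1
  ring

theorem weinstein_gaussianL2 {p : ℝ} (hp : 3 < p) :
    weinstein p ⟨gaussianL2, gaussianL2_mem_H1⟩ =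
      ENNReal.ofReal (2 ^ ((p - 7) / 4) / (Real.pi ^ ((p - 3) / 4) * (p + 1) ^ (1 / 2 : ℝ)) *
          (Real.Gamma ((p - 3) / 4) / Real.Gamma ((p - 1) / 4))) := by
  have hpi := Real.pi_pos
  have hg := norm_weakDeriv_gaussianL2
    (hasWeakDeriv_weakDeriv ⟨gaussianL2, gaussianL2_mem_H1⟩)
  rw [weinstein, hg]
  simp only
  rw [norm_gaussianL2, spaceTimeNormPow_gaussianL2 (by linarith),
    ← ENNReal.ofReal_div_of_pos (by positivity)]
  congr 1
  rw [show (p + 1 - 2) / 4 - 1 / 2 = (p - 3) / 4 by ring, show (p + 1 - 2) / 4 = (p - 1) / 4 by ring,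
    Real.mul_rpow (by positivity) (by positivity), ← Real.rpow_mul hpi.le,
    ← Real.rpow_mul zero_le_two, ← Real.rpow_mul zero_le_two, Real.rpow_neg (by linarith)]
  -- The powers of 2 and of π are balanced separately, by comparing exponents; the rest is algebra
  -- in positive quantities.
  have h4 : (4 : ℝ) = 2 ^ (2 : ℝ) := by norm_num
  have e2 : (2 : ℝ) ^ ((p - 7) / 4) * 4 * (2 ^ (-(1 / 4) * ((p + 7) / 2)) *
      2 ^ (-(1 / 4) * ((p - 5) / 2))) = 1 := by
    rw [h4, ← Real.rpow_add two_pos, ← Real.rpow_add two_pos, ← Real.rpow_add two_pos,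
      ← Real.rpow_zero 2]
    congr 1
    ring
  have e3 : Real.pi ^ ((p - 3) / 4) * √Real.pi = Real.pi * Real.pi ^ (1 / 2 * ((p - 5) / 2)) := by
    rw [Real.sqrt_eq_rpow, ← Real.rpow_add hpi, ← Real.rpow_one_add' hpi.le (by linarith)]
    congr 1
    ring
  set A := (2 : ℝ) ^ ((p - 7) / 4)
  set B := (2 : ℝ) ^ (-(1 / 4) * ((p + 7) / 2))
  set C := (2 : ℝ) ^ (-(1 / 4) * ((p - 5) / 2))
  have hB : 0 < B := by positivity
  have hC : 0 < C := by positivity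
  have hP : 0 < Real.pi ^ ((p - 3) / 4) := by positivity
  have hR : 0 < Real.pi ^ (1 / 2 * ((p - 5) / 2)) := by positivity
  have hp1 : 0 < (p + 1) ^ (1 / 2 : ℝ) := Real.rpow_pos_of_pos (by linarith) _
  have hA : A = 1 / (4 * (B * C)) := by
    field_simp
    linear_combination e2
  have hs : √Real.pi = Real.pi * Real.pi ^ (1 / 2 * ((p - 5) / 2)) / Real.pi ^ ((p - 3) / 4) := by
    rw [eq_div_iff hP.ne']
    linear_combination e3
  rw [hA, hs]
  field_simp

theorem le_sharpConst {p : ℝ} (hp : 3 < p) :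
    ENNReal.ofReal (2 ^ ((p - 7) / 4) / (Real.pi ^ ((p - 3) / 4) * (p + 1) ^ (1 / 2 : ℝ)) *
          (Real.Gamma ((p - 3) / 4) / Real.Gamma ((p - 1) / 4))) ≤ sharpConst p := by
  rw [← weinstein_gaussianL2 hp]
  exact le_iSup₂_of_le (f := fun (f : H1) (_ : (f : L2) ≠ 0) => weinstein p f)
    ⟨gaussianL2, gaussianL2_mem_H1⟩ gaussianL2_ne_zero le_rfl

theorem betaIntegral_one_half {b : ℝ} (hb : 0 < b) :
    Complex.betaIntegral (1 / 2) (b : ℂ) =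
      ((Real.pi ^ (1 / 2 : ℝ) * Real.Gamma b / Real.Gamma (b + 1 / 2) : ℝ) : ℂ) := by
  rw [Complex.betaIntegral_eq_Gamma_mul_div _ _ (by norm_num) (by simpa using hb),
    ← Real.sqrt_eq_rpow, ← Real.Gamma_one_half_eq]
  push_cast [← Complex.Gamma_ofReal]
  rw [add_comm]

end GabitovTuritsyn

theorem lemma4p1 :
    (∀ p : ℝ, 9 ≤ p →
      (((2 ^ ((p - 7) / 4) / (Real.pi ^ ((p - 1) / 4) * (p + 1) ^ (1 / 2 : ℝ)) : ℝ) : ℂ) *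
          Complex.betaIntegral (1 / 2) (((p - 3) / 4 : ℝ) : ℂ) =
        ((2 ^ ((p - 7) / 4) / (Real.pi ^ ((p - 3) / 4) * (p + 1) ^ (1 / 2 : ℝ)) *
          (Real.Gamma ((p - 3) / 4) / Real.Gamma ((p - 1) / 4)) : ℝ) : ℂ)) ∧
      ENNReal.ofReal (2 ^ ((p - 7) / 4) / (Real.pi ^ ((p - 3) / 4) * (p + 1) ^ (1 / 2 : ℝ)) *
          (Real.Gamma ((p - 3) / 4) / Real.Gamma ((p - 1) / 4))) ≤
        GabitovTuritsyn.sharpConst p ∧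
      GabitovTuritsyn.sharpConst p ≤ ENNReal.ofReal (1 / (2 * √3))) ∧
    ENNReal.ofReal (1 / (2 * √5 * Real.pi)) ≤ GabitovTuritsyn.sharpConst 9 ∧
    GabitovTuritsyn.sharpConst 9 ≤ ENNReal.ofReal (1 / (2 * √3)) := by
  have hpi := Real.pi_pos
  refine ⟨fun p hp => ⟨?_, GabitovTuritsyn.le_sharpConst (by linarith),
    GabitovTuritsyn.sharpConst_le (by linarith)⟩, ?_,
    GabitovTuritsyn.sharpConst_le (by norm_num)⟩
  · rw [GabitovTuritsyn.betaIntegral_one_half (by linarith), ← Complex.ofReal_mul]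
    congr 1
    rw [show (p - 3) / 4 + 1 / 2 = (p - 1) / 4 by ring,
      show (p - 1) / 4 = (p - 3) / 4 + 1 / 2 by ring, Real.rpow_add hpi]
    have : Real.pi ^ (1 / 2 : ℝ) ≠ 0 := by positivity
    field_simp
  · refine le_trans (le_of_eq ?_) (GabitovTuritsyn.le_sharpConst (p := 9) (by norm_num))
    congr 1
    have hG : Real.Gamma ((9 - 3) / 4) = √Real.pi / 2 := by
      rw [show ((9 : ℝ) - 3) / 4 = 1 / 2 + 1 by norm_num, Real.Gamma_add_one (by norm_num),
        Real.Gamma_one_half_eq]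
      ring
    have hG2 : Real.Gamma ((9 - 1) / 4) = 1 := by
      rw [show ((9 : ℝ) - 1) / 4 = 2 by norm_num, Real.Gamma_two]
    have h1 : (2 : ℝ) ^ (((9 : ℝ) - 7) / 4) = √2 := by
      rw [Real.sqrt_eq_rpow]
      norm_num
    have h2 : Real.pi ^ (((9 : ℝ) - 3) / 4) = Real.pi * √Real.pi := by
      rw [show ((9 : ℝ) - 3) / 4 = 1 + 1 / 2 by norm_num, Real.rpow_add hpi, Real.rpow_one,
        Real.sqrt_eq_rpow]
    have h3 : ((9 : ℝ) + 1) ^ (1 / 2 : ℝ) = √2 * √5 := by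
      rw [← Real.sqrt_eq_rpow, ← Real.sqrt_mul (by norm_num)]
      norm_num
    rw [hG, hG2, h1, h2, h3]
    field_simp
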